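/- Let $H$ be a complex Hilbert space (not necessarily separable) with $\dim H>1$, and let $B_s(H)^+$ be the set of all positive bounded linear operators on $H$, that is, the self-adjoint bounded linear operators $A$ with $\langle Ax,x\rangle\ge 0$ for every $x\in H$. For $A,B\in B_s(H)^+$ write $A\le B$ if $\langle Ax,x\rangle\le\langle Bx,x\rangle$ for every $x\in H$. Let $\phi:B_s(H)^+\to B_s(H)^+$ be a bijective map (no linearity or continuity is assumed) such that \[ A\le B\iff\phi(A)\le\phi(B)\qquad (A,B\in B_s(H)^+). \] Then there exists an invertible bounded operator $T:H\to H$, either linear or conjugate-linear, such that \[ \phi(A)=TAT^*\qquad (A\in B_s(H)^+). \] Here, for a conjugate-linear bounded operator $T$, the adjoint $T^*$ is the conjugate-linear bounded operator determined by $\langle Tx,y\rangle=\overline{\langle x,T^*y\rangle}$ for all $x,y\in H$. -/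

import Mathlib

open scoped ComplexConjugate InnerProductSpace

noncomputable section

variable {H : Type*} [NormedAddCommGroup H] [InnerProductSpace ℂ H] [CompleteSpace H]

variable (H) in
/-- The cone of positive bounded operators on the complex Hilbert space `H`, with the order
`A ≤ B` if and only if `B - A` is positive, inherited from Mathlib's Loewner order on
`H →L[ℂ] H`. -/
abbrev PosOp : Type _ := {A : H →L[ℂ] H // A.IsPositive}

/-- The adjoint of a bounded conjugate-linear operator `T`: the bounded conjugate-linear operator
`T*` with `⟪T* y, x⟫ = ⟪T x, y⟫` for all `x` and `y`. For fixed `y` the right-hand side is a bounded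
linear functional of `x`, and `T* y` is the vector that represents it. -/
def conjAdjoint (T : H →L⋆[ℂ] H) : H →L⋆[ℂ] H :=
  LinearMap.mkContinuous
    { toFun := fun y => (InnerProductSpace.toDual ℂ H).symm (((innerSL ℂ).flip y).comp T)
      map_add' := fun y z => by simp
      map_smul' := fun c y => by
        rw [map_smul, ContinuousLinearMap.smul_comp]
        exact map_smulₛₗ _ c _ }
    ‖T‖ (fun y => by
      simp only [LinearMap.coe_mk, AddHom.coe_mk, LinearIsometryEquiv.norm_map]
      refine ContinuousLinearMap.opNorm_le_bound _ (by positivity) fun x => ?_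
      calc ‖⟪T x, y⟫_ℂ‖ ≤ ‖T x‖ * ‖y‖ := norm_inner_le_norm _ _
        _ ≤ ‖T‖ * ‖x‖ * ‖y‖ := by gcongr; exact T.le_opNorm x
        _ = ‖T‖ * ‖y‖ * ‖x‖ := by ring)

theorem conjAdjoint_inner (T : H →L⋆[ℂ] H) (x y : H) :
    ⟪conjAdjoint T y, x⟫_ℂ = ⟪T x, y⟫_ℂ := by
  simp [conjAdjoint]

end

noncomputable section

set_option linter.unusedSectionVars false

variable {H : Type*} [NormedAddCommGroup H] [InnerProductSpace ℂ H] [CompleteSpace H]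

open InnerProductSpace

/-! The order detects rank one: a positive operator is some `x ⊗ x*` exactly when the order interval
below it is a chain. Applied to the interval from `A` to `A + x ⊗ x*`, this shows that an order
automorphism `e` changes by a rank-one operator along each such step (`exists_map_addSq`), and a
growth argument shows that the direction of the change is independent of `A`
(`exists_map_addSq_eq_add_smul`).

Two steps in independent directions commute, so comparing coefficients makes the size of a step
insensitive to the other one. Since `dim H > 1`, this yields additivity on sums of two rank-one
operators (`map_sq_addSq`). Hence `Q x = e (x ⊗ x*)` satisfies the parallelogram law, scales by
`|c|²`, and is bounded because `e` is monotone.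

Polarizing `Q` around a vector `x₀` with `Q x₀ = a ⊗ a*`, `a` a unit vector, turns `Q (c x₀ + z)`
into a Hermitian polynomial in `c` whose values all have rank at most one. The vanishing of its 2×2
minors forces the linear coefficient to be `q ⊗ a*` or `a ⊗ q*`, with the same alternative for all
`z`. The two alternatives give `Q x = T x ⊗ (T x)*` with `T` linear or conjugate-linear
(`exists_linear_or_conjLinear`). Finally a positive operator is determined by the rank-one operators
below it, so `e A = T A T*` (`eq_of_forall_inner`). -/

/-! ### Positive operators and the rank-one operators below them. -/

/-- The rank-one operator `x ⊗ x*`. -/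
abbrev sqOp (x : H) : H →L[ℂ] H := rankOne ℂ x x

theorem sqOp_nonneg (x : H) : 0 ≤ sqOp x :=
  (ContinuousLinearMap.nonneg_iff_isPositive _).2 (isPositive_rankOne_self x)

theorem sqOp_smul (c : ℂ) (x : H) : sqOp (c • x) = (‖c‖ ^ 2 : ℝ) • sqOp x := by
  ext v
  simp only [sqOp, rankOne_apply, smul_apply, inner_smul_left, smul_smul]
  rw [← Complex.coe_smul, smul_smul]
  congr 1
  push_cast
  rw [← Complex.mul_conj']
  ring

theorem sqOp_sqrt_smul {t : ℝ} (ht : 0 ≤ t) (x : H) :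
    sqOp ((Real.sqrt t : ℂ) • x) = t • sqOp x := by
  rw [sqOp_smul, Complex.norm_real, Real.norm_of_nonneg (Real.sqrt_nonneg t), Real.sq_sqrt ht]

theorem re_inner_sqOp (x u : H) : (⟪sqOp x u, u⟫_ℂ).re = ‖⟪x, u⟫_ℂ‖ ^ 2 := by
  simp only [sqOp, rankOne_apply, inner_smul_left, ← Complex.normSq_eq_norm_sq]
  rw [mul_comm, Complex.mul_conj]
  simp

theorem re_inner_le_of_le {A B : H →L[ℂ] H} (h : A ≤ B) (u : H) :
    (⟪A u, u⟫_ℂ).re ≤ (⟪B u, u⟫_ℂ).re := by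
  have := ((ContinuousLinearMap.le_def A B).1 h).re_inner_nonneg_left u
  rw [sub_apply, inner_sub_left, map_sub, sub_nonneg] at this
  exact this

theorem le_of_re_inner_le {A B : H →L[ℂ] H} (hA : 0 ≤ A) (hB : 0 ≤ B)
    (h : ∀ u, (⟪A u, u⟫_ℂ).re ≤ (⟪B u, u⟫_ℂ).re) : A ≤ B := by
  rw [ContinuousLinearMap.le_def, ContinuousLinearMap.isPositive_def']
  refine ⟨(IsSelfAdjoint.of_nonneg hB).sub (IsSelfAdjoint.of_nonneg hA), fun u => ?_⟩
  rw [ContinuousLinearMap.reApplyInnerSelf_apply, sub_apply, inner_sub_left, map_sub, sub_nonneg]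
  exact h u

theorem re_inner_nonneg {A : H →L[ℂ] H} (hA : 0 ≤ A) (u : H) : 0 ≤ (⟪A u, u⟫_ℂ).re := by
  simpa using re_inner_le_of_le hA u

/-- The Cauchy-Schwarz inequality for a positive operator. -/
theorem norm_inner_sq_le {A : H →L[ℂ] H} (hA : 0 ≤ A) (u v : H) :
    ‖⟪A u, v⟫_ℂ‖ ^ 2 ≤ (⟪A u, u⟫_ℂ).re * (⟪A v, v⟫_ℂ).re := by
  obtain ⟨S, rfl⟩ := CStarAlgebra.nonneg_iff_eq_star_mul_self.1 hA
  have key : ∀ a b : H, ⟪(star S * S) a, b⟫_ℂ = ⟪S a, S b⟫_ℂ := fun a b => by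
    rw [ContinuousLinearMap.star_eq_adjoint, mul_apply_eq_comp,
      ContinuousLinearMap.adjoint_inner_left]
  simp only [key]
  have h1 : ∀ a : H, (⟪S a, S a⟫_ℂ).re = ‖S a‖ ^ 2 := fun a => by
    simpa using inner_self_eq_norm_sq (𝕜 := ℂ) (S a)
  rw [h1, h1, ← mul_pow]
  gcongr
  exact norm_inner_le_norm _ _

theorem apply_eq_zero_of_re_inner {A : H →L[ℂ] H} (hA : 0 ≤ A) {u : H}
    (hu : (⟪A u, u⟫_ℂ).re = 0) : A u = 0 := by
  have h := norm_inner_sq_le hA u (A u)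
  rw [hu, zero_mul] at h
  have : ‖⟪A u, A u⟫_ℂ‖ = 0 := by nlinarith [norm_nonneg ⟪A u, A u⟫_ℂ]
  simpa using this

/-- A positive operator dominates `(A x) ⊗ (A x)* / ⟪A x, x⟫`. -/
theorem exists_sqOp_le {A : H →L[ℂ] H} (hA : 0 ≤ A) (x : H) :
    ∃ y : H, sqOp y ≤ A ∧ (⟪sqOp y x, x⟫_ℂ).re = (⟪A x, x⟫_ℂ).re ∧ sqOp y x = A x := by
  set a := (⟪A x, x⟫_ℂ).re with ha
  have ha0 : 0 ≤ a := re_inner_nonneg hA x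
  rcases ha0.eq_or_lt with h0 | hpos
  · refine ⟨0, ?_, ?_, ?_⟩
    · simpa [sqOp] using hA
    · simp [sqOp, ← h0]
    · simp [sqOp, apply_eq_zero_of_re_inner hA h0.symm]
  have hreal : ⟪A x, x⟫_ℂ = (a : ℂ) := by
    have h1 := ((ContinuousLinearMap.nonneg_iff_isPositive A).1 hA).inner_nonneg_left x
    apply Complex.ext
    · simp [ha]
    · simpa using (Complex.le_def.1 h1).2.symm
  have hs : sqOp ((Real.sqrt a⁻¹ : ℂ) • A x) = a⁻¹ • sqOp (A x) :=
    sqOp_sqrt_smul (inv_nonneg.2 ha0) _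
  have hx : sqOp ((Real.sqrt a⁻¹ : ℂ) • A x) x = A x := by
    rw [hs, smul_apply, sqOp, rankOne_apply, hreal, Complex.coe_smul,
      smul_smul, inv_mul_cancel₀ hpos.ne', one_smul]
  refine ⟨(Real.sqrt a⁻¹ : ℂ) • A x, le_of_re_inner_le (sqOp_nonneg _) hA fun u => ?_,
    by rw [hx], hx⟩
  have h2 := norm_inner_sq_le hA x u
  rw [hs, smul_apply, ← Complex.coe_smul, inner_smul_left]
  rw [Complex.conj_ofReal, Complex.re_ofReal_mul, re_inner_sqOp]
  rw [inv_mul_le_iff₀ hpos]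
  exact h2

/-- A positive operator is determined by the rank-one operators below it. -/
theorem le_of_forall_sqOp_le {A B : H →L[ℂ] H} (hA : 0 ≤ A) (hB : 0 ≤ B)
    (h : ∀ x, sqOp x ≤ A → sqOp x ≤ B) : A ≤ B := by
  refine le_of_re_inner_le hA hB fun u => ?_
  obtain ⟨y, hy, hyu, -⟩ := exists_sqOp_le hA u
  rw [← hyu]
  exact re_inner_le_of_le (h y hy) u

/-- The form of `C` vanishes on the orthogonal complement of `x`, so `C` does too by Cauchy-Schwarz;
symmetry then puts the range of `C` on the line of `x`. -/
theorem exists_eq_smul_of_le_sqOp {C : H →L[ℂ] H} (hC : 0 ≤ C) {x : H} (h : C ≤ sqOp x) :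
    ∃ t : ℝ, 0 ≤ t ∧ C = t • sqOp x := by
  have hker : ∀ u, ⟪x, u⟫_ℂ = 0 → C u = 0 := fun u hu => by
    apply apply_eq_zero_of_re_inner hC
    have := re_inner_le_of_le h u
    rw [re_inner_sqOp, hu] at this
    simp only [norm_zero, ne_eq, OfNat.ofNat_ne_zero, not_false_eq_true, zero_pow] at this
    exact le_antisymm this (re_inner_nonneg hC u)
  rcases eq_or_ne x 0 with rfl | hx
  · refine ⟨0, le_rfl, ?_⟩
    ext u
    simpa using hker u (by simp)
  have hxx : ⟪x, x⟫_ℂ ≠ 0 := by simpa using hx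
  have hn : (0 : ℝ) < ‖x‖ ^ 2 := by positivity
  have hdec : ∀ u, C u = (⟪x, u⟫_ℂ / ⟪x, x⟫_ℂ) • C x := fun u => by
    have : C (u - (⟪x, u⟫_ℂ / ⟪x, x⟫_ℂ) • x) = 0 := by
      apply hker
      rw [inner_sub_right, inner_smul_right, div_mul_cancel₀ _ hxx, sub_self]
    rwa [map_sub, map_smul, sub_eq_zero] at this
  have hsym : ∀ u v, ⟪C u, v⟫_ℂ = ⟪u, C v⟫_ℂ :=
    ((ContinuousLinearMap.nonneg_iff_isPositive C).1 hC).inner_left_eq_inner_right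
  have hCx : C x = (⟪x, C x⟫_ℂ / ⟪x, x⟫_ℂ) • x := by
    refine ext_inner_right ℂ fun v => ?_
    rw [hsym, hdec v, inner_smul_right, inner_smul_left, map_div₀, inner_conj_symm,
      inner_conj_symm, hsym]
    ring
  have hreal : ⟪x, C x⟫_ℂ = ((⟪C x, x⟫_ℂ).re : ℂ) := by
    have h1 := ((ContinuousLinearMap.nonneg_iff_isPositive C).1 hC).inner_nonneg_left x
    rw [← hsym]
    apply Complex.ext
    · simp
    · simpa using (Complex.le_def.1 h1).2.symm
  have hxx2 : ⟪x, x⟫_ℂ = (‖x‖ : ℂ) ^ 2 := inner_self_eq_norm_sq_to_K x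
  have hk := re_inner_nonneg hC x
  generalize (⟪C x, x⟫_ℂ).re = k at hreal hk
  refine ⟨k / ‖x‖ ^ 2 / ‖x‖ ^ 2, by positivity, ?_⟩
  · ext u
    rw [hdec u, hCx, smul_apply, sqOp, rankOne_apply, hreal,
      ← Complex.coe_smul, smul_smul, smul_smul, hxx2]
    congr 1
    push_cast
    ring

/-- The chain condition on the order interval `[0, C]` characterizes operators of rank at most
one. -/
theorem exists_eq_sqOp_of_chain {C : H →L[ℂ] H} (hC : 0 ≤ C)
    (h : ∀ D E : H →L[ℂ] H, 0 ≤ D → 0 ≤ E → D ≤ C → E ≤ C → D ≤ E ∨ E ≤ D) :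
    ∃ x : H, C = sqOp x := by
  by_cases hz : C = 0
  · exact ⟨0, by simp [sqOp, hz]⟩
  have : ∃ x, C x ≠ 0 := by
    by_contra! hcon
    exact hz (by ext u; simp [hcon u])
  obtain ⟨x, hx⟩ := this
  obtain ⟨y, hy, hyx, hyx'⟩ := exists_sqOp_le hC x
  -- `C - sqOp y` kills `x` while `sqOp y` agrees with `C` there, so only the first comparison is
  -- possible, and it makes `C` a multiple of `sqOp y`.
  rcases h (C - sqOp y) (sqOp y) (sub_nonneg.2 hy) (sqOp_nonneg y)
    (sub_le_self C (sqOp_nonneg y)) hy with h1 | h1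
  · obtain ⟨t, ht, hCt⟩ := exists_eq_smul_of_le_sqOp (sub_nonneg.2 hy) h1
    refine ⟨(Real.sqrt (t + 1) : ℂ) • y, ?_⟩
    rw [sqOp_sqrt_smul (by positivity), add_smul, one_smul, ← hCt, sub_add_cancel]
  · have h2 := re_inner_le_of_le h1 x
    have h3 : (C - sqOp y) x = 0 := by rw [sub_apply, hyx', sub_self]
    rw [h3, hyx, inner_zero_left, Complex.zero_re] at h2
    exact absurd (apply_eq_zero_of_re_inner hC (le_antisymm h2 (re_inner_nonneg hC x))) hx

theorem sqOp_le_or_le_of_eq_smul {A B : H →L[ℂ] H} (hA : 0 ≤ A) {t : ℝ}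
    (h : B = t • A) : A ≤ B ∨ B ≤ A := by
  rcases le_total 1 t with h1 | h1
  · left
    rw [h]
    simpa using smul_le_smul_of_nonneg_right h1 hA
  · right
    rw [h]
    simpa using smul_le_smul_of_nonneg_right h1 hA

theorem chain_of_le_sqOp {C D : H →L[ℂ] H} {x : H} (hC : 0 ≤ C) (hD : 0 ≤ D)
    (hCx : C ≤ sqOp x) (hDx : D ≤ sqOp x) : C ≤ D ∨ D ≤ C := by
  obtain ⟨s, hs, rfl⟩ := exists_eq_smul_of_le_sqOp hC hCx
  obtain ⟨t, ht, rfl⟩ := exists_eq_smul_of_le_sqOp hD hDx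
  rcases le_total s t with h | h
  · exact Or.inl (smul_le_smul_of_nonneg_right h (sqOp_nonneg x))
  · exact Or.inr (smul_le_smul_of_nonneg_right h (sqOp_nonneg x))

theorem exists_smul_eq_of_inner_eq_zero {a b : H} (h : ∀ u, ⟪b, u⟫_ℂ = 0 → ⟪a, u⟫_ℂ = 0) :
    ∃ c : ℂ, a = c • b := by
  rcases eq_or_ne b 0 with rfl | hb
  · exact ⟨0, by simpa using h a (by simp)⟩
  have hbb : ⟪b, b⟫_ℂ ≠ 0 := by simpa using hb
  set c := ⟪b, a⟫_ℂ / ⟪b, b⟫_ℂ with hc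
  have h1 : ⟪b, a - c • b⟫_ℂ = 0 := by
    rw [inner_sub_right, inner_smul_right, hc, div_mul_cancel₀ _ hbb, sub_self]
  have h2 : ⟪a - c • b, a - c • b⟫_ℂ = 0 := by
    rw [inner_sub_left, inner_smul_left, h1, h _ h1, mul_zero, sub_zero]
  exact ⟨c, sub_eq_zero.1 (inner_self_eq_zero.1 h2)⟩

theorem exists_smul_of_sqOp_le {a b : H} (h : sqOp a ≤ sqOp b) : ∃ c : ℂ, a = c • b := by
  refine exists_smul_eq_of_inner_eq_zero fun u hu => ?_
  have := re_inner_le_of_le h u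
  rw [re_inner_sqOp, re_inner_sqOp, hu] at this
  have h0 : ‖⟪a, u⟫_ℂ‖ = 0 := by
    simp only [norm_zero] at this
    nlinarith [norm_nonneg ⟪a, u⟫_ℂ]
  simpa using h0

theorem sqOp_eq_zero {x : H} : sqOp x = 0 ↔ x = 0 := by simp [sqOp]

theorem exists_sqOp_eq_smul_of_comparable {a b : H} (hb : b ≠ 0)
    (h : sqOp a ≤ sqOp b ∨ sqOp b ≤ sqOp a) : ∃ s : ℝ, 0 ≤ s ∧ sqOp a = s • sqOp b := by
  rcases h with h | h
  · exact exists_eq_smul_of_le_sqOp (sqOp_nonneg a) h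
  · obtain ⟨t, ht, h1⟩ := exists_eq_smul_of_le_sqOp (sqOp_nonneg b) h
    have ht0 : t ≠ 0 := by
      rintro rfl
      rw [zero_smul, sqOp_eq_zero] at h1
      exact hb h1
    exact ⟨t⁻¹, inv_nonneg.2 ht, by rw [h1, smul_smul, inv_mul_cancel₀ ht0, one_smul]⟩

/-- The one place where the dimension hypothesis is used directly: otherwise every vector would be a
multiple of `z`. -/
theorem exists_ne_zero_inner_eq_zero (hdim : 1 < Module.rank ℂ H) (z : H) :
    ∃ w : H, w ≠ 0 ∧ ⟪z, w⟫_ℂ = 0 := by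
  by_contra! hcon
  refine absurd (rank_le_one_iff.2 ⟨z, fun v => ?_⟩) (not_le.2 hdim)
  obtain ⟨c, hc⟩ := exists_smul_eq_of_inner_eq_zero (a := v) (b := z) fun u hu => by
    by_contra hne
    refine hcon u ?_ hu
    rintro rfl
    simp at hne
  exact ⟨c, hc.symm⟩

/-! ### Order automorphisms of the cone and rank-one increments. -/

/-- Adding a rank-one operator to a positive operator. -/
def PosOp.addSq (A : PosOp H) (x : H) : PosOp H :=
  ⟨A + sqOp x, A.2.add (isPositive_rankOne_self x)⟩

/-- The rank-one operator `x ⊗ x*` as an element of the cone. -/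
def PosOp.sq (x : H) : PosOp H := ⟨sqOp x, isPositive_rankOne_self x⟩

theorem PosOp.nonneg (A : PosOp H) : 0 ≤ (A : H →L[ℂ] H) :=
  (ContinuousLinearMap.nonneg_iff_isPositive _).2 A.2

theorem PosOp.coe_addSq (A : PosOp H) (x : H) :
    (A.addSq x : H →L[ℂ] H) = A + sqOp x := rfl

theorem PosOp.coe_sq (x : H) : (PosOp.sq x : H →L[ℂ] H) = sqOp x := rfl

theorem PosOp.addSq_comm (A : PosOp H) (x z : H) :
    (A.addSq x).addSq z = (A.addSq z).addSq x :=
  Subtype.ext (add_right_comm _ _ _)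

theorem PosOp.le_addSq (A : PosOp H) (x : H) : A ≤ A.addSq x :=
  Subtype.coe_le_coe.1 (le_add_of_nonneg_right (sqOp_nonneg x))

theorem PosOp.sq_le_addSq (A : PosOp H) (x : H) : PosOp.sq x ≤ A.addSq x :=
  Subtype.coe_le_coe.1 (le_add_of_nonneg_left A.nonneg)

theorem PosOp.sq_zero_addSq (x : H) : (PosOp.sq (0 : H)).addSq x = PosOp.sq x :=
  Subtype.ext (by simp [PosOp.coe_addSq, PosOp.coe_sq, sqOp])

theorem PosOp.sq_zero_le (A : PosOp H) : PosOp.sq 0 ≤ A := by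
  rw [← Subtype.coe_le_coe, PosOp.coe_sq, sqOp_eq_zero.2 rfl]
  exact A.nonneg

variable (e : PosOp H ≃o PosOp H)

theorem map_sq_zero : e (PosOp.sq 0) = PosOp.sq 0 :=
  le_antisymm (e.le_symm_apply.1 (PosOp.sq_zero_le _)) (PosOp.sq_zero_le _)

/-- The interval from `A` to `A + x ⊗ x*` is a chain, `e` carries it onto the interval between the
images, and translating by `-e A` makes the chain criterion for rank one applicable. -/
theorem exists_map_addSq (A : PosOp H) (x : H) :
    ∃ y, (e (A.addSq x) : H →L[ℂ] H) = (e A : H →L[ℂ] H) + sqOp y := by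
  have hle : (e A : H →L[ℂ] H) ≤ e (A.addSq x) :=
    Subtype.coe_le_coe.2 (e.monotone (A.le_addSq x))
  have key : ∀ D : H →L[ℂ] H, 0 ≤ D → D ≤ (e (A.addSq x) : H →L[ℂ] H) - e A →
      ∃ D' : PosOp H, (e D' : H →L[ℂ] H) = e A + D ∧ A ≤ D' ∧ D' ≤ A.addSq x := by
    intro D hD hDle
    refine ⟨e.symm ⟨e A + D, (e A).2.add
      ((ContinuousLinearMap.nonneg_iff_isPositive D).1 hD)⟩, ?_, ?_, ?_⟩
    · rw [e.apply_symm_apply]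
    · rw [e.le_symm_apply, ← Subtype.coe_le_coe]
      exact le_add_of_nonneg_right hD
    · rw [e.symm_apply_le, ← Subtype.coe_le_coe]
      exact le_sub_iff_add_le'.1 hDle
  obtain ⟨y, hy⟩ := exists_eq_sqOp_of_chain (sub_nonneg.2 hle) (fun D E hD hE hDl hEl => by
    obtain ⟨D', hD', hAD, hDA⟩ := key D hD hDl
    obtain ⟨E', hE', hAE, hEA⟩ := key E hE hEl
    have hcmp := chain_of_le_sqOp (C := (D' : H →L[ℂ] H) - (A : H →L[ℂ] H))
      (D := (E' : H →L[ℂ] H) - (A : H →L[ℂ] H))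
      (x := x) (sub_nonneg.2 hAD) (sub_nonneg.2 hAE)
      (sub_le_iff_le_add'.2 hDA) (sub_le_iff_le_add'.2 hEA)
    rw [sub_le_sub_iff_right, sub_le_sub_iff_right, Subtype.coe_le_coe, Subtype.coe_le_coe,
      ← e.le_iff_le, ← e.le_iff_le (x := E'), ← Subtype.coe_le_coe, ← Subtype.coe_le_coe, hD',
      hE', add_le_add_iff_left, add_le_add_iff_left] at hcmp
    exact hcmp)
  exact ⟨y, by rw [← hy, add_sub_cancel]⟩

/-- The image of `x ⊗ x*`. -/
abbrev sqImage (x : H) : H →L[ℂ] H := e (PosOp.sq x)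

theorem exists_sqImage_eq (x : H) : ∃ y, sqImage e x = sqOp y := by
  obtain ⟨y, hy⟩ := exists_map_addSq e (PosOp.sq 0) x
  refine ⟨y, ?_⟩
  rw [PosOp.sq_zero_addSq, map_sq_zero, PosOp.coe_sq, sqOp_eq_zero.2 rfl, zero_add] at hy
  exact hy

theorem exists_eq_sqImage (y : H) : ∃ x, sqImage e x = sqOp y := by
  obtain ⟨x, hx⟩ := exists_sqImage_eq e.symm y
  refine ⟨x, ?_⟩
  have : e.symm (PosOp.sq y) = PosOp.sq x := Subtype.ext hx
  rw [sqImage, ← this, e.apply_symm_apply, PosOp.coe_sq]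

theorem sqImage_le_iff (x z : H) : sqImage e x ≤ sqImage e z ↔ sqOp x ≤ sqOp z := by
  rw [sqImage, sqImage, Subtype.coe_le_coe, e.le_iff_le, ← Subtype.coe_le_coe, PosOp.coe_sq,
    PosOp.coe_sq]

theorem sqImage_nonneg (x : H) : 0 ≤ sqImage e x := PosOp.nonneg _

theorem sqImage_zero : sqImage e 0 = 0 := by
  rw [sqImage, map_sq_zero, PosOp.coe_sq, sqOp_eq_zero]

theorem sqImage_eq_zero {x : H} : sqImage e x = 0 ↔ x = 0 := by
  refine ⟨fun h => ?_, fun h => by rw [h, sqImage_zero]⟩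
  have h1 := (sqImage_le_iff e x 0).1 (by rw [h, sqImage_zero])
  rw [sqOp_eq_zero.2 rfl] at h1
  exact sqOp_eq_zero.1 (le_antisymm h1 (sqOp_nonneg x))

theorem exists_sqImage_eq_smul {x x' : H} (hx : x ≠ 0)
    (h : sqOp x' ≤ sqOp x ∨ sqOp x ≤ sqOp x') :
    ∃ s : ℝ, 0 ≤ s ∧ sqImage e x' = s • sqImage e x := by
  obtain ⟨y, hy⟩ := exists_sqImage_eq e x
  obtain ⟨y', hy'⟩ := exists_sqImage_eq e x'
  rw [← sqImage_le_iff e, ← sqImage_le_iff e, hy, hy'] at h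
  rw [hy, hy']
  refine exists_sqOp_eq_smul_of_comparable ?_ h
  rintro rfl
  exact hx ((sqImage_eq_zero e).1 (by rw [hy, sqOp_eq_zero]))

/-- The direction of the increment of `e` along `x ⊗ x*` does not depend on the base point. -/
theorem exists_map_addSq_eq_add_smul {x : H} (hx : x ≠ 0) (A : PosOp H) :
    ∃ k : ℝ, (e (A.addSq x) : H →L[ℂ] H) = e A + k • sqImage e x := by
  obtain ⟨w, hw⟩ := exists_map_addSq e A x
  obtain ⟨y, hy⟩ := exists_sqImage_eq e x
  have hy0 : y ≠ 0 := by
    rintro rfl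
    exact hx ((sqImage_eq_zero e).1 (by rw [hy, sqOp_eq_zero]))
  have hw0 : w ≠ 0 := by
    rintro rfl
    rw [sqOp_eq_zero.2 rfl, add_zero] at hw
    have h1 := congrArg Subtype.val (e.injective (Subtype.ext hw))
    rw [PosOp.coe_addSq, add_eq_left, sqOp_eq_zero] at h1
    exact hx h1
  have hperp : ∀ u, ⟪w, u⟫_ℂ = 0 → ⟪y, u⟫_ℂ = 0 := by
    intro u hu
    by_contra hne
    have hpos : 0 < ‖⟪y, u⟫_ℂ‖ ^ 2 := by positivity
    set m := (⟪(e A : H →L[ℂ] H) u, u⟫_ℂ).re with hm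
    have hm0 : 0 ≤ m := re_inner_nonneg (PosOp.nonneg _) u
    -- Chosen so that the form of `s • sqOp y` at `u` is `m + 1`. The increment over `e A` stays a
    -- multiple of `sqOp w`, which contributes nothing at `u`, so domination would give `m + 1 ≤ m`.
    set s := (m + 1) / ‖⟪y, u⟫_ℂ‖ ^ 2 with hs
    have hs0 : 0 ≤ s := by positivity
    obtain ⟨x', hx'⟩ := exists_eq_sqImage e ((Real.sqrt s : ℂ) • y)
    rw [sqOp_sqrt_smul hs0, ← hy] at hx'
    have hcomp : sqOp x ≤ sqOp x' ∨ sqOp x' ≤ sqOp x := by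
      rw [← sqImage_le_iff e, ← sqImage_le_iff e]
      exact sqOp_le_or_le_of_eq_smul (sqImage_nonneg e x) hx'
    obtain ⟨w', hw'⟩ := exists_map_addSq e A x'
    have hcomp' : sqOp w' ≤ sqOp w ∨ sqOp w ≤ sqOp w' := by
      have hiff : ∀ a b v v', (e (A.addSq a) : H →L[ℂ] H) = (e A : H →L[ℂ] H) + sqOp v →
          (e (A.addSq b) : H →L[ℂ] H) = (e A : H →L[ℂ] H) + sqOp v' →
          sqOp a ≤ sqOp b → sqOp v ≤ sqOp v' := by
        intro a b v v' hv hv' hab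
        have : A.addSq a ≤ A.addSq b := by
          rw [← Subtype.coe_le_coe, PosOp.coe_addSq, PosOp.coe_addSq]
          gcongr
        have := Subtype.coe_le_coe.2 (e.monotone this)
        rwa [hv, hv', add_le_add_iff_left] at this
      exact hcomp.symm.imp (hiff _ _ _ _ hw' hw) (hiff _ _ _ _ hw hw')
    obtain ⟨r, -, hr⟩ := exists_sqOp_eq_smul_of_comparable hw0 hcomp'
    have hle : sqImage e x' ≤ e (A.addSq x') :=
      Subtype.coe_le_coe.2 (e.monotone (A.sq_le_addSq x'))
    rw [hx', hw', hy, hr] at hle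
    have h2 := re_inner_le_of_le hle u
    simp only [add_apply, smul_apply, inner_add_left, Complex.add_re, ← Complex.coe_smul,
      inner_smul_left, Complex.conj_ofReal, Complex.re_ofReal_mul, re_inner_sqOp, hu] at h2
    rw [hs, div_mul_cancel₀ _ hpos.ne', ← hm] at h2
    simp at h2
    linarith
  obtain ⟨c, hc⟩ := exists_smul_eq_of_inner_eq_zero hperp
  have hc0 : c ≠ 0 := by
    rintro rfl
    exact hy0 (by simpa using hc)
  refine ⟨(‖c‖ ^ 2)⁻¹, ?_⟩
  rw [hw, hy, hc, sqOp_smul, smul_smul, inv_mul_cancel₀ (by positivity), one_smul]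

/-! ### Additivity on rank-one operators. -/

/-- Reaching `A + x ⊗ x* + z ⊗ z*` in both orders gives two expansions in the non-proportional
operators `sqImage e x` and `sqImage e z`, so the coefficient of `sqImage e x` is the same at both
base points. -/
theorem map_addSq_addSq_iff {x z : H} (hx : x ≠ 0) (hz : z ≠ 0)
    (h : ¬ (sqOp x ≤ sqOp z ∨ sqOp z ≤ sqOp x)) (A : PosOp H) :
    (e (A.addSq x) : H →L[ℂ] H) = e A + sqImage e x ↔
      (e ((A.addSq z).addSq x) : H →L[ℂ] H) = e (A.addSq z) + sqImage e x := by
  obtain ⟨k₁, hk₁⟩ := exists_map_addSq_eq_add_smul e hx A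
  obtain ⟨k₂, hk₂⟩ := exists_map_addSq_eq_add_smul e hx (A.addSq z)
  obtain ⟨m₁, hm₁⟩ := exists_map_addSq_eq_add_smul e hz A
  obtain ⟨m₂, hm₂⟩ := exists_map_addSq_eq_add_smul e hz (A.addSq x)
  have heq : k₁ = k₂ := by
    by_contra hne
    have h1 : (k₁ - k₂) • sqImage e x = (m₁ - m₂) • sqImage e z := by
      rw [PosOp.addSq_comm, hk₁] at hm₂
      rw [hm₂, hm₁] at hk₂
      rw [sub_smul, sub_smul, sub_eq_sub_iff_add_eq_add]
      rw [add_assoc, add_assoc] at hk₂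
      exact add_left_cancel hk₂
    have h2 : sqImage e x = ((k₁ - k₂)⁻¹ * (m₁ - m₂)) • sqImage e z := by
      rw [← smul_smul, ← h1, smul_smul, inv_mul_cancel₀ (sub_ne_zero.2 hne), one_smul]
    have h3 := sqOp_le_or_le_of_eq_smul (sqImage_nonneg e z) h2
    rw [sqImage_le_iff, sqImage_le_iff] at h3
    exact h h3.symm
  have hcancel : ∀ (k : ℝ) (B : H →L[ℂ] H), B + k • sqImage e x = B + sqImage e x ↔ k = 1 := by
    intro k B
    rw [add_right_inj]
    refine ⟨fun h => ?_, fun h => by rw [h, one_smul]⟩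
    have h1 : (k - 1) • sqImage e x = 0 := by rw [sub_smul, h, one_smul, sub_self]
    rcases smul_eq_zero.1 h1 with h2 | h2
    · linarith
    · exact absurd ((sqImage_eq_zero e).1 h2) hx
  rw [hk₁, hk₂, hcancel, hcancel, heq]

theorem sqOp_add_add_sqOp_sub (x z : H) :
    sqOp (x + z) + sqOp (x - z) = (2 : ℝ) • sqOp x + (2 : ℝ) • sqOp z := by
  simp only [sqOp, map_add, map_sub, add_apply, sub_apply]
  module

theorem map_sq_addSq (hdim : 1 < Module.rank ℂ H) (x z : H) :
    (e ((PosOp.sq x).addSq z) : H →L[ℂ] H) = sqImage e x + sqImage e z := by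
  rcases eq_or_ne z 0 with rfl | hz
  · have : (PosOp.sq x).addSq 0 = PosOp.sq x :=
      Subtype.ext (by simp [PosOp.coe_addSq, sqOp])
    rw [this, sqImage_zero, add_zero]
  have hbase : (e ((PosOp.sq 0).addSq z) : H →L[ℂ] H) = e (PosOp.sq 0) + sqImage e z := by
    rw [PosOp.sq_zero_addSq, map_sq_zero, PosOp.coe_sq, sqOp_eq_zero.2 rfl, zero_add]
  rcases eq_or_ne x 0 with rfl | hx
  · exact hbase
  by_cases hcomp : sqOp z ≤ sqOp x ∨ sqOp x ≤ sqOp z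
  swap
  · have := (map_addSq_addSq_iff e hz hx hcomp (PosOp.sq 0)).1 hbase
    rwa [PosOp.sq_zero_addSq] at this
  -- For parallel `x` and `z` the transfer makes a detour through directions not parallel to `z`:
  -- from `0` to `x ⊗ x* + w ⊗ w*` by way of `(x ± w)/√2`, then back by removing `w ⊗ w*`.
  obtain ⟨w, hw0, hzw⟩ := exists_ne_zero_inner_eq_zero hdim z
  have hxz : ∃ c : ℂ, x = c • z := by
    rcases hcomp with h | h
    · obtain ⟨c, hc⟩ := exists_smul_of_sqOp_le h
      have hc0 : c ≠ 0 := by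
        rintro rfl
        exact hz (by simpa using hc)
      exact ⟨c⁻¹, by rw [hc, smul_smul, inv_mul_cancel₀ hc0, one_smul]⟩
    · exact exists_smul_of_sqOp_le h
  obtain ⟨c, rfl⟩ := hxz
  have hww : ⟪w, w⟫_ℂ ≠ 0 := by simpa using hw0
  have hncomp : ∀ v : H, ⟪v, w⟫_ℂ ≠ 0 → v ≠ 0 ∧ ¬ (sqOp z ≤ sqOp v ∨ sqOp v ≤ sqOp z) := by
    intro v hv
    refine ⟨fun h => hv (by simp [h]), ?_⟩
    intro h
    obtain ⟨s, -, hs⟩ := exists_sqOp_eq_smul_of_comparable hz h.symm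
    have h1 := congrArg (fun T : H →L[ℂ] H => (⟪T w, w⟫_ℂ).re) hs
    simp only [smul_apply, ← Complex.coe_smul, inner_smul_left, Complex.conj_ofReal,
      Complex.re_ofReal_mul, re_inner_sqOp, hzw] at h1
    simp at h1
    exact hv h1
  set r : ℂ := (Real.sqrt (1 / 2) : ℂ) with hr
  have hr0 : r ≠ 0 := by
    rw [hr, Complex.ofReal_ne_zero]
    positivity
  obtain ⟨hp0, hp⟩ := hncomp (r • (c • z + w)) (by
    simp [hzw, hr0, hw0])
  obtain ⟨hq0, hq⟩ := hncomp (r • (c • z - w)) (by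
    simp [hzw, hr0, hw0])
  obtain ⟨-, hw⟩ := hncomp w hww
  have hsum : ((PosOp.sq 0).addSq (r • (c • z + w))).addSq (r • (c • z - w)) =
      (PosOp.sq (c • z)).addSq w := by
    apply Subtype.ext
    rw [PosOp.sq_zero_addSq]
    simp only [PosOp.coe_addSq, PosOp.coe_sq]
    rw [hr, sqOp_sqrt_smul (by norm_num), sqOp_sqrt_smul (by norm_num), ← smul_add,
      sqOp_add_add_sqOp_sub]
    module
  have h1 := (map_addSq_addSq_iff e hz hp0 hp _).1 hbase
  have h2 := (map_addSq_addSq_iff e hz hq0 hq _).1 h1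
  rw [hsum] at h2
  exact (map_addSq_addSq_iff e hz hw0 hw _).2 h2

/-! ### Homogeneity, parallelogram law and boundedness. -/

/-- Cauchy's equation for a monotone function: squeezing `n * t` between consecutive integers bounds
`n` times the error by `f 1`. -/
theorem eq_mul_of_add_of_nonneg {f : ℝ → ℝ} (hadd : ∀ s t, 0 ≤ s → 0 ≤ t → f (s + t) = f s + f t)
    (hf : ∀ t, 0 ≤ t → 0 ≤ f t) {t : ℝ} (ht : 0 ≤ t) : f t = t * f 1 := by
  have hmono : ∀ s t, 0 ≤ s → s ≤ t → f s ≤ f t := fun s t hs hst => by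
    have := hadd s (t - s) hs (sub_nonneg.2 hst)
    rw [add_sub_cancel] at this
    linarith [hf (t - s) (sub_nonneg.2 hst)]
  have hnat : ∀ (n : ℕ) (s : ℝ), 0 ≤ s → f (n * s) = n * f s := by
    intro n s hs
    induction n with
    | zero =>
      have := hadd 0 0 le_rfl le_rfl
      simp only [CharP.cast_eq_zero, zero_mul]
      rw [add_zero] at this
      linarith
    | succ n ih =>
      push_cast
      rw [add_mul, one_mul, hadd _ _ (by positivity) hs, ih]
      ring
  have hbound : ∀ n : ℕ, n * |f t - t * f 1| ≤ f 1 := by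
    intro n
    have hnt : 0 ≤ (n : ℝ) * t := by positivity
    have h1 := hmono _ _ (Nat.cast_nonneg _) (Nat.floor_le hnt)
    have h2 := hmono _ _ hnt (Nat.lt_floor_add_one (n * t)).le
    have h3 := hnat ⌊n * t⌋₊ 1 zero_le_one
    have h4 := hadd ⌊n * t⌋₊ 1 (Nat.cast_nonneg _) zero_le_one
    rw [mul_one] at h3
    rw [hnat n t ht] at h1 h2
    rw [h4] at h2
    rw [h3] at h1 h2
    have h5 := mul_le_mul_of_nonneg_right (Nat.floor_le hnt) (hf 1 zero_le_one)
    have h6 := mul_le_mul_of_nonneg_right (Nat.lt_floor_add_one (n * t)).le (hf 1 zero_le_one)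
    rw [← Nat.abs_cast n, ← abs_mul, abs_le]
    constructor <;> nlinarith
  by_contra hne
  have hpos : 0 < |f t - t * f 1| := abs_pos.2 (sub_ne_zero.2 hne)
  obtain ⟨n, hn⟩ := exists_nat_gt (f 1 / |f t - t * f 1|)
  rw [div_lt_iff₀ hpos] at hn
  linarith [hbound n]

theorem sqImage_sqrt_smul (hdim : 1 < Module.rank ℂ H) {t : ℝ} (ht : 0 ≤ t) (x : H) :
    sqImage e ((Real.sqrt t : ℂ) • x) = t • sqImage e x := by
  rcases eq_or_ne x 0 with rfl | hx
  · simp [sqImage_zero]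
  have hex : ∀ t : ℝ, ∃ s : ℝ, 0 ≤ t → 0 ≤ s ∧
      sqImage e ((Real.sqrt t : ℂ) • x) = s • sqImage e x := fun t => by
    by_cases ht : 0 ≤ t
    · obtain ⟨s, hs⟩ := exists_sqImage_eq_smul e hx
        (sqOp_le_or_le_of_eq_smul (sqOp_nonneg x) (sqOp_sqrt_smul ht x)).symm
      exact ⟨s, fun _ => hs⟩
    · exact ⟨0, fun h => absurd h ht⟩
  choose f hf using hex
  have hne : sqImage e x ≠ 0 := fun h => hx ((sqImage_eq_zero e).1 h)
  have h1 : f 1 = 1 := by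
    have := (hf 1 zero_le_one).2
    rw [Real.sqrt_one, Complex.ofReal_one, one_smul] at this
    refine smul_left_injective ℝ hne ?_
    simpa using this.symm
  have hadd : ∀ s t, 0 ≤ s → 0 ≤ t → f (s + t) = f s + f t := fun s t hs ht => by
    refine smul_left_injective ℝ hne ?_
    show f (s + t) • sqImage e x = (f s + f t) • sqImage e x
    rw [add_smul, ← (hf _ hs).2, ← (hf _ ht).2, ← (hf _ (add_nonneg hs ht)).2,
      ← map_sq_addSq e hdim]
    have : PosOp.sq ((Real.sqrt (s + t) : ℂ) • x) =
        (PosOp.sq ((Real.sqrt s : ℂ) • x)).addSq ((Real.sqrt t : ℂ) • x) := by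
      apply Subtype.ext
      simp only [PosOp.coe_addSq, PosOp.coe_sq]
      rw [sqOp_sqrt_smul (add_nonneg hs ht), sqOp_sqrt_smul hs, sqOp_sqrt_smul ht, add_smul]
    rw [sqImage, this]
  rw [(hf t ht).2, eq_mul_of_add_of_nonneg hadd (fun t ht => (hf t ht).1) ht, h1, mul_one]

theorem sqImage_smul (hdim : 1 < Module.rank ℂ H) (c : ℂ) (x : H) :
    sqImage e (c • x) = (‖c‖ ^ 2 : ℝ) • sqImage e x := by
  rw [← sqImage_sqrt_smul e hdim (by positivity)]
  refine congrArg (fun A : PosOp H => (e A : H →L[ℂ] H)) (Subtype.ext ?_)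
  rw [PosOp.coe_sq, PosOp.coe_sq, sqOp_sqrt_smul (by positivity), sqOp_smul]

/-- Additivity makes both sides the value of `e` at one and the same operator. -/
theorem sqImage_parallelogram (hdim : 1 < Module.rank ℂ H) (x z : H) :
    sqImage e (x + z) + sqImage e (x - z) = (2 : ℝ) • sqImage e x + (2 : ℝ) • sqImage e z := by
  have h2 : (0 : ℝ) ≤ 2 := by norm_num
  rw [← map_sq_addSq e hdim, ← sqImage_sqrt_smul e hdim h2, ← sqImage_sqrt_smul e hdim h2,
    ← map_sq_addSq e hdim]
  congr 2
  apply Subtype.ext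
  simp only [PosOp.coe_addSq, PosOp.coe_sq]
  rw [sqOp_sqrt_smul h2, sqOp_sqrt_smul h2, sqOp_add_add_sqOp_sub]

/-- For a unit vector `x ⊗ x* ≤ 1`, so monotonicity bounds its image by that of the identity. -/
theorem norm_sqImage_le (hdim : 1 < Module.rank ℂ H) :
    ∃ C : ℝ, 0 ≤ C ∧ ∀ x, ‖sqImage e x‖ ≤ C * ‖x‖ ^ 2 := by
  set I : PosOp H := ⟨1, ContinuousLinearMap.isPositive_one⟩ with hI
  refine ⟨‖(e I : H →L[ℂ] H)‖, norm_nonneg _, fun x => ?_⟩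
  rcases eq_or_ne x 0 with rfl | hx
  · simp [sqImage_zero]
  have hn : ‖x‖ ≠ 0 := by simpa using hx
  have hle : sqImage e ((‖x‖⁻¹ : ℂ) • x) ≤ e I := by
    refine Subtype.coe_le_coe.2 (e.monotone (Subtype.coe_le_coe.1 ?_))
    refine le_of_re_inner_le (sqOp_nonneg _) I.nonneg fun u => ?_
    rw [PosOp.coe_sq, re_inner_sqOp, hI]
    have h1 : (⟪(1 : H →L[ℂ] H) u, u⟫_ℂ).re = ‖u‖ ^ 2 := by
      simpa using inner_self_eq_norm_sq (𝕜 := ℂ) u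
    rw [h1]
    gcongr
    refine (norm_inner_le_norm _ _).trans_eq ?_
    rw [norm_smul]
    simp [hn]
  have h2 := CStarAlgebra.norm_le_norm_of_nonneg_of_le (sqImage_nonneg e _) hle
  rw [sqImage_smul e hdim, norm_smul] at h2
  have h3 : ‖(‖((‖x‖⁻¹ : ℂ))‖ ^ 2 : ℝ)‖ = (‖x‖ ^ 2)⁻¹ := by simp
  rw [h3, inv_mul_le_iff₀ (by positivity)] at h2
  linarith

/-! ### Polarization of operator-valued quadratic maps. -/

theorem smul_eq_re_smul_add_im_smul {E : Type*} [AddCommGroup E] [Module ℂ E] (c : ℂ) (x : E) :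
    c • x = c.re • x + c.im • (Complex.I • x) := by
  nth_rewrite 1 [← Complex.re_add_im c]
  rw [add_smul, mul_smul, Complex.coe_smul, Complex.coe_smul]

/-- A bounded operator-valued function satisfying the parallelogram law is a Hermitian quadratic
form: it can be polarized around any vector. -/
theorem exists_polarization {Q : H → H →L[ℂ] H}
    (hpar : ∀ x z, Q (x + z) + Q (x - z) = (2 : ℝ) • Q x + (2 : ℝ) • Q z)
    (hsmul : ∀ (c : ℂ) x, Q (c • x) = (‖c‖ ^ 2 : ℝ) • Q x)
    (hbdd : ∃ C : ℝ, 0 ≤ C ∧ ∀ x, ‖Q x‖ ≤ C * ‖x‖ ^ 2) (hsa : ∀ x, star (Q x) = Q x) (x₀ : H) :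
    ∃ L : H →ₗ[ℂ] (H →L[ℂ] H), ∀ (c : ℂ) (z : H),
      Q (c • x₀ + z) = (‖c‖ ^ 2 : ℝ) • Q x₀ + conj c • L z + c • star (L z) + Q z := by
  have hneg : ∀ x, Q (-x) = Q x := fun x => by simpa using hsmul (-1) x
  have hzero : Q 0 = 0 := by simpa using hsmul 0 0
  let P : H → H → H →L[ℂ] H := fun x z => Q (x + z) - Q (x - z)
  have hP : ∀ x z, P x z = Q (x + z) - Q (x - z) := fun x z => rfl
  have hsymm : ∀ x z, P x z = P z x := fun x z => by
    rw [hP, hP, add_comm x z, ← hneg (x - z), neg_sub]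
  have hhalf : ∀ x x' z, P x z + P x' z = (1 / 2 : ℝ) • P (x + x') ((2 : ℝ) • z) := fun x x' z => by
    have h1 := hpar (x + z) (x' + z)
    have h2 := hpar (x - z) (x' - z)
    have e1 : x + z + (x' + z) = x + x' + (2 : ℝ) • z := by module
    have e2 : x - z + (x' - z) = x + x' - (2 : ℝ) • z := by module
    have e3 : x + z - (x' + z) = x - z - (x' - z) := by abel
    rw [e1, e3] at h1
    rw [e2] at h2
    have e4 : P (x + x') ((2 : ℝ) • z) = (2 : ℝ) • (P x z + P x' z) := by
      rw [hP, hP, hP]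
      linear_combination (norm := module) h1 - h2
    rw [e4, smul_smul]
    norm_num
  have hP0 : ∀ z, P 0 z = 0 := fun z => by rw [hP, zero_add, zero_sub, hneg, sub_self]
  have hadd : ∀ x x' z, P (x + x') z = P x z + P x' z := fun x x' z => by
    have h1 := hhalf (x + x') 0 z
    rw [hP0, add_zero, add_zero] at h1
    rw [h1, hhalf]
  obtain ⟨C, hC0, hC⟩ := hbdd
  let f : H → H →+ (H →L[ℂ] H) := fun z =>
    { toFun := fun x => P x z
      map_zero' := hP0 z
      map_add' := fun x x' => hadd x x' z }
  -- Boundedness near zero upgrades additivity to real linearity.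
  have hcont : ∀ z, Continuous (f z) := fun z => by
    refine AddMonoidHom.continuous_of_isBounded_nhds_zero (f z)
      (Metric.ball_mem_nhds 0 one_pos) ?_
    rw [isBounded_iff_forall_norm_le]
    refine ⟨C * (1 + ‖z‖) ^ 2 + C * (1 + ‖z‖) ^ 2, ?_⟩
    rintro _ ⟨x, hx, rfl⟩
    have hx1 : ‖x‖ ≤ 1 := by
      rw [mem_ball_zero_iff] at hx
      exact hx.le
    refine (norm_sub_le _ _).trans (add_le_add ?_ ?_)
    · refine (hC _).trans ?_
      gcongr
      exact (norm_add_le _ _).trans (by gcongr)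
    · refine (hC _).trans ?_
      gcongr
      exact (norm_sub_le _ _).trans (by gcongr)
  have hreal : ∀ (t : ℝ) x z, P (t • x) z = t • P x z := fun t x z =>
    map_real_smul (f z) (hcont z) t x
  have hI : ∀ x z, P (Complex.I • x) z = -P x (Complex.I • z) := fun x z => by
    have e1 : Complex.I • x + z = Complex.I • (x - Complex.I • z) := by
      rw [smul_sub, smul_smul, Complex.I_mul_I]
      module
    have e2 : Complex.I • x - z = Complex.I • (x + Complex.I • z) := by
      rw [smul_add, smul_smul, Complex.I_mul_I]
      module
    rw [hP, hP, e1, e2, hsmul, hsmul]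
    simp
  have hII : ∀ x z, P (Complex.I • x) (Complex.I • z) = P x z := fun x z => by
    rw [hP, hP, ← smul_add, ← smul_sub, hsmul, hsmul]
    simp
  let l : H → H →L[ℂ] H := fun z =>
    (1 / 4 : ℂ) • (P z x₀ + Complex.I • P z (Complex.I • x₀))
  have hl : ∀ z, l z = (1 / 4 : ℂ) • (P z x₀ + Complex.I • P z (Complex.I • x₀)) := fun z => rfl
  have hI_smul : ∀ X : H →L[ℂ] H, Complex.I • Complex.I • X = -X := fun X => by
    rw [smul_smul, Complex.I_mul_I, neg_one_smul]
  have hladd : ∀ z z', l (z + z') = l z + l z' := fun z z' => by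
    rw [hl, hl, hl, hadd, hadd]
    module
  have hlI : ∀ z, l (Complex.I • z) = Complex.I • l z := fun z => by
    rw [hl, hl, hI, hII]
    linear_combination (norm := module) (-1 / 4 : ℂ) • hI_smul (P z (Complex.I • x₀))
  have hlreal : ∀ (t : ℝ) z, l (t • z) = t • l z := fun t z => by
    rw [hl, hl, hreal, hreal, ← Complex.coe_smul, ← Complex.coe_smul, ← Complex.coe_smul]
    module
  refine ⟨{ toFun := l, map_add' := hladd, map_smul' := fun c z => ?_ }, fun c z => ?_⟩
  · show l (c • z) = c • l z
    rw [smul_eq_re_smul_add_im_smul c z, smul_eq_re_smul_add_im_smul c (l z), hladd, hlreal,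
      hlreal, hlI]
  · show Q (c • x₀ + z) = (‖c‖ ^ 2 : ℝ) • Q x₀ + conj c • l z + c • star (l z) + Q z
    have hsaP : ∀ x y, star (P x y) = P x y := fun x y => by rw [hP, star_sub, hsa, hsa]
    have hstar : star (l z) = (1 / 4 : ℂ) • (P z x₀ - Complex.I • P z (Complex.I • x₀)) := by
      rw [hl, star_smul, star_add, star_smul, hsaP, hsaP]
      simp [sub_eq_add_neg]
    have e2 : P z (c • x₀) = c.re • P z x₀ + c.im • P z (Complex.I • x₀) := by
      rw [hsymm, smul_eq_re_smul_add_im_smul, hadd, hreal, hreal, hsymm x₀, hsymm (Complex.I • x₀)]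
    have e3 : (2 : ℝ) • Q (c • x₀ + z) =
        (2 : ℝ) • Q (c • x₀) + (2 : ℝ) • Q z + P z (c • x₀) := by
      rw [hsymm, hP, ← hpar]
      module
    have e4 : Q (c • x₀ + z) = Q (c • x₀) + Q z + (1 / 2 : ℝ) • P z (c • x₀) := by
      have := congrArg (fun X => (1 / 2 : ℝ) • X) e3
      simp only [smul_add, smul_smul] at this
      norm_num at this
      exact this
    have e5 : conj c • l z + c • star (l z) = (1 / 2 : ℝ) • P z (c • x₀) := by
      have hc : conj c = c.re - c.im * Complex.I := by
        apply Complex.ext <;> simp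
      have hc' : c • star (l z) = ((c.re : ℂ) + c.im * Complex.I) • star (l z) := by
        rw [Complex.re_add_im]
      rw [hc', hc, hstar, hl, e2]
      simp only [← Complex.coe_smul]
      push_cast
      linear_combination (norm := module)
        (-(c.im : ℂ) / 2) • hI_smul (P z (Complex.I • x₀))
    rw [e4, hsmul, ← e5]
    abel

/-! ### Pencils of operators of rank at most one. -/

/-- The nine monomials in `c` and its conjugate are linearly independent. The samples `0`, `±1`,
`±i`, `±2`, `±2i`, `±(1 + i)` suffice, opposite points separating even from odd degree. -/
theorem coeffs_eq_zero {p₁ p₂ p₃ p₄ p₅ p₆ p₇ p₈ p₉ : ℂ}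
    (h : ∀ c : ℂ, ((‖c‖ ^ 2 : ℝ) : ℂ) ^ 2 * p₁ + ((‖c‖ ^ 2 : ℝ) : ℂ) * c * p₂ +
      ((‖c‖ ^ 2 : ℝ) : ℂ) * conj c * p₃ + c ^ 2 * p₄ + conj c ^ 2 * p₅ +
      ((‖c‖ ^ 2 : ℝ) : ℂ) * p₆ + c * p₇ + conj c * p₈ + p₉ = 0) :
    p₃ = 0 ∧ p₅ = 0 ∧ p₆ = 0 ∧ p₇ = 0 ∧ p₈ = 0 ∧ p₉ = 0 := by
  set I := Complex.I with hIdef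
  have hI : I * I = -1 := Complex.I_mul_I
  have hI0 : I ≠ 0 := Complex.I_ne_zero
  have hexp : ∀ s t : ℝ, ((s : ℂ) ^ 2 + t ^ 2) ^ 2 * p₁ + (s ^ 2 + t ^ 2) * (s + t * I) * p₂ +
      (s ^ 2 + t ^ 2) * (s - t * I) * p₃ + (s + t * I) ^ 2 * p₄ + (s - t * I) ^ 2 * p₅ +
      (s ^ 2 + t ^ 2) * p₆ + (s + t * I) * p₇ + (s - t * I) * p₈ + p₉ = 0 := by
    intro s t
    have h1 : ((‖(s + t * I : ℂ)‖ ^ 2 : ℝ) : ℂ) = s ^ 2 + t ^ 2 := by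
      rw [← Complex.normSq_eq_norm_sq, Complex.normSq_add_mul_I]
      push_cast
      rfl
    have h2 : conj (s + t * I : ℂ) = s - t * I := by simp [hIdef, sub_eq_add_neg]
    have := h (s + t * I)
    rwa [h1, h2] at this
  have h0 := hexp 0 0
  have h1 := hexp 1 0
  have h2 := hexp (-1) 0
  have h3 := hexp 0 1
  have h4 := hexp 0 (-1)
  have h5 := hexp 2 0
  have h6 := hexp (-2) 0
  have h7 := hexp 0 2
  have h8 := hexp 0 (-2)
  have h9 := hexp 1 1
  have h10 := hexp (-1) (-1)
  push_cast at h0 h1 h2 h3 h4 h5 h6 h7 h8 h9 h10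
  have g9 : p₉ = 0 := by linear_combination h0
  have o1 : p₂ + p₃ + (p₇ + p₈) = 0 := by linear_combination (1 / 2) * (h1 - h2)
  have o2 : 4 * (p₂ + p₃) + (p₇ + p₈) = 0 := by linear_combination (1 / 4) * (h5 - h6)
  have o3 : p₂ - p₃ + (p₇ - p₈) = 0 :=
    mul_left_cancel₀ hI0 (by linear_combination (1 / 2) * (h3 - h4))
  have o4 : 4 * (p₂ - p₃) + (p₇ - p₈) = 0 :=
    mul_left_cancel₀ hI0 (by linear_combination (1 / 4) * (h7 - h8))
  have e1 : p₁ + p₄ + p₅ + p₆ = 0 := by linear_combination (1 / 2) * (h1 + h2) - g9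
  have e2 : p₁ - p₄ - p₅ + p₆ = 0 := by
    linear_combination (1 / 2) * (h3 + h4) - g9 - (p₄ + p₅) * hI
  have e3 : 4 * p₁ + p₄ + p₅ + p₆ = 0 := by linear_combination (1 / 8) * (h5 + h6) - g9 / 4
  have e4 : 4 * p₁ + 2 * p₆ + 2 * I * p₄ - 2 * I * p₅ = 0 := by
    linear_combination (1 / 2) * (h9 + h10) - g9 - (p₄ + p₅) * hI
  have g1 : p₁ = 0 := by linear_combination (1 / 3) * (e3 - e1)
  have g6 : p₆ = 0 := by linear_combination (1 / 2) * (e1 + e2) - g1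
  have g45 : p₄ - p₅ = 0 :=
    mul_left_cancel₀ hI0 (by linear_combination (1 / 2) * e4 - 2 * g1 - g6)
  refine ⟨?_, ?_, g6, ?_, ?_, g9⟩
  · linear_combination (1 / 6) * (o2 - o1 - o4 + o3)
  · linear_combination (1 / 2) * (e1 - g1 - g6 - g45)
  · linear_combination (1 / 6) * (4 * o1 - o2 + 4 * o3 - o4)
  · linear_combination (1 / 6) * (4 * o1 - o2 - 4 * o3 + o4)

theorem minor_coeffs {a₁ a₂ a₃ a₄ l₁ l₂ l₃ l₄ m₁ m₂ m₃ m₄ b₁ b₂ b₃ b₄ : ℂ}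
    (h : ∀ c : ℂ, (((‖c‖ ^ 2 : ℝ) : ℂ) * a₁ + conj c * l₁ + c * m₁ + b₁) *
        (((‖c‖ ^ 2 : ℝ) : ℂ) * a₂ + conj c * l₂ + c * m₂ + b₂) =
      (((‖c‖ ^ 2 : ℝ) : ℂ) * a₃ + conj c * l₃ + c * m₃ + b₃) *
        (((‖c‖ ^ 2 : ℝ) : ℂ) * a₄ + conj c * l₄ + c * m₄ + b₄)) :
    l₁ * l₂ = l₃ * l₄ ∧ a₁ * l₂ + l₁ * a₂ = a₃ * l₄ + l₃ * a₄ ∧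
      a₁ * b₂ + b₁ * a₂ + l₁ * m₂ + m₁ * l₂ = a₃ * b₄ + b₃ * a₄ + l₃ * m₄ + m₃ * l₄ ∧
      l₁ * b₂ + b₁ * l₂ = l₃ * b₄ + b₃ * l₄ ∧ m₁ * b₂ + b₁ * m₂ = m₃ * b₄ + b₃ * m₄ ∧
      b₁ * b₂ = b₃ * b₄ := by
  obtain ⟨g₁, g₂, g₃, g₄, g₅, g₆⟩ := coeffs_eq_zero
    (p₁ := a₁ * a₂ - a₃ * a₄) (p₂ := a₁ * m₂ + m₁ * a₂ - a₃ * m₄ - m₃ * a₄)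
    (p₃ := a₁ * l₂ + l₁ * a₂ - a₃ * l₄ - l₃ * a₄) (p₄ := m₁ * m₂ - m₃ * m₄)
    (p₅ := l₁ * l₂ - l₃ * l₄)
    (p₆ := a₁ * b₂ + b₁ * a₂ - a₃ * b₄ - b₃ * a₄ + (l₁ * m₂ + m₁ * l₂ - l₃ * m₄ - m₃ * l₄))
    (p₇ := m₁ * b₂ + b₁ * m₂ - m₃ * b₄ - b₃ * m₄) (p₈ := l₁ * b₂ + b₁ * l₂ - l₃ * b₄ - b₃ * l₄)
    (p₉ := b₁ * b₂ - b₃ * b₄) (fun c => by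
      have hn : ((‖c‖ ^ 2 : ℝ) : ℂ) = conj c * c := by
        rw [Complex.conj_mul']
        push_cast
        rfl
      linear_combination h c + (l₁ * m₂ + m₁ * l₂ - l₃ * m₄ - m₃ * l₄) * hn)
  refine ⟨?_, ?_, ?_, ?_, ?_, ?_⟩
  · linear_combination g₂
  · linear_combination g₁
  · linear_combination g₃
  · linear_combination g₅
  · linear_combination g₄
  · linear_combination g₆

theorem sqOp_minor (y u v w p : H) :
    ⟪v, sqOp y u⟫_ℂ * ⟪p, sqOp y w⟫_ℂ = ⟪p, sqOp y u⟫_ℂ * ⟪v, sqOp y w⟫_ℂ := by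
  simp only [sqOp, rankOne_apply, inner_smul_right]
  ring

/-- A Hermitian pencil of operators of the form `y ⊗ y*`, given by its coefficients. -/
def IsSqPencil (A L M B : H →L[ℂ] H) : Prop :=
  ∀ c : ℂ, ∃ y, (‖c‖ ^ 2 : ℝ) • A + conj c • L + c • M + B = sqOp y

theorem IsSqPencil.symm {A L M B : H →L[ℂ] H} (h : IsSqPencil A L M B) : IsSqPencil A M L B := by
  intro c
  obtain ⟨y, hy⟩ := h (conj c)
  refine ⟨y, ?_⟩
  rw [← hy, Complex.norm_conj, Complex.conj_conj, add_right_comm (_ • A) (c • L)]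

theorem IsSqPencil.minors {A L M B : H →L[ℂ] H} (h : IsSqPencil A L M B) (u v w p : H) :
    ⟪v, L u⟫_ℂ * ⟪p, L w⟫_ℂ = ⟪p, L u⟫_ℂ * ⟪v, L w⟫_ℂ ∧
      ⟪v, A u⟫_ℂ * ⟪p, L w⟫_ℂ + ⟪v, L u⟫_ℂ * ⟪p, A w⟫_ℂ =
        ⟪p, A u⟫_ℂ * ⟪v, L w⟫_ℂ + ⟪p, L u⟫_ℂ * ⟪v, A w⟫_ℂ ∧
      ⟪v, A u⟫_ℂ * ⟪p, B w⟫_ℂ + ⟪v, B u⟫_ℂ * ⟪p, A w⟫_ℂ + ⟪v, L u⟫_ℂ * ⟪p, M w⟫_ℂ +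
          ⟪v, M u⟫_ℂ * ⟪p, L w⟫_ℂ =
        ⟪p, A u⟫_ℂ * ⟪v, B w⟫_ℂ + ⟪p, B u⟫_ℂ * ⟪v, A w⟫_ℂ + ⟪p, L u⟫_ℂ * ⟪v, M w⟫_ℂ +
          ⟪p, M u⟫_ℂ * ⟪v, L w⟫_ℂ ∧
      ⟪v, L u⟫_ℂ * ⟪p, B w⟫_ℂ + ⟪v, B u⟫_ℂ * ⟪p, L w⟫_ℂ =
        ⟪p, L u⟫_ℂ * ⟪v, B w⟫_ℂ + ⟪p, B u⟫_ℂ * ⟪v, L w⟫_ℂ ∧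
      ⟪v, M u⟫_ℂ * ⟪p, B w⟫_ℂ + ⟪v, B u⟫_ℂ * ⟪p, M w⟫_ℂ =
        ⟪p, M u⟫_ℂ * ⟪v, B w⟫_ℂ + ⟪p, B u⟫_ℂ * ⟪v, M w⟫_ℂ ∧
      ⟪v, B u⟫_ℂ * ⟪p, B w⟫_ℂ = ⟪p, B u⟫_ℂ * ⟪v, B w⟫_ℂ := by
  refine minor_coeffs fun c => ?_
  obtain ⟨y, hy⟩ := h c
  have hval : ∀ r s : H, ((‖c‖ ^ 2 : ℝ) : ℂ) * ⟪s, A r⟫_ℂ + conj c * ⟪s, L r⟫_ℂ +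
      c * ⟪s, M r⟫_ℂ + ⟪s, B r⟫_ℂ = ⟪s, sqOp y r⟫_ℂ := fun r s => by
    rw [← hy]
    simp only [add_apply, smul_apply, inner_add_right, inner_smul_right, ← Complex.coe_smul]
  rw [hval, hval, hval, hval]
  exact sqOp_minor y u v w p

theorem inner_sqOp (a u v : H) : ⟪v, sqOp a u⟫_ℂ = ⟪a, u⟫_ℂ * ⟪v, a⟫_ℂ := by
  rw [sqOp, rankOne_apply, inner_smul_right]

/-- The linear coefficient of a pencil with leading coefficient `a ⊗ a*` is `q ⊗ a*` or
`a ⊗ q*`. -/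
theorem IsSqPencil.linear_coeff {a : H} (ha : ⟪a, a⟫_ℂ = 1) {L M B : H →L[ℂ] H}
    (h : IsSqPencil (sqOp a) L M B) :
    (∀ u, L u = ⟪a, u⟫_ℂ • L a) ∨ (∀ u, L u = ⟪a, L u⟫_ℂ • a) := by
  have hL : ∀ u v, ⟪v, L u⟫_ℂ = ⟪a, u⟫_ℂ * ⟪v, L a⟫_ℂ + ⟪v, a⟫_ℂ * ⟪a, L u⟫_ℂ -
      ⟪a, u⟫_ℂ * ⟪v, a⟫_ℂ * ⟪a, L a⟫_ℂ := fun u v => by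
    have h2 := (h.minors u v a a).2.1
    simp only [inner_sqOp, ha] at h2
    linear_combination h2
  -- A function of `u` times a function of `v` vanishes identically, so one factor does; this is the
  -- source of the dichotomy.
  have hprod : ∀ u v, (⟪a, L u⟫_ℂ - ⟪a, L a⟫_ℂ * ⟪a, u⟫_ℂ) *
      (⟪v, L a⟫_ℂ - ⟪a, L a⟫_ℂ * ⟪v, a⟫_ℂ) = 0 := fun u v => by
    have h1 := (h.minors u v a a).1
    linear_combination -h1 + ⟪a, L a⟫_ℂ * hL u v
  by_cases hcase : ∀ u, ⟪a, L u⟫_ℂ - ⟪a, L a⟫_ℂ * ⟪a, u⟫_ℂ = 0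
  · left
    intro u
    refine ext_inner_left ℂ fun v => ?_
    rw [inner_smul_right]
    linear_combination hL u v + ⟪v, a⟫_ℂ * hcase u
  · right
    push Not at hcase
    obtain ⟨u₀, hu₀⟩ := hcase
    intro u
    refine ext_inner_left ℂ fun v => ?_
    rw [inner_smul_right]
    linear_combination hL u v + ⟪a, u⟫_ℂ * (mul_eq_zero.1 (hprod u₀ v)).resolve_left hu₀

/-- The `|c|²` minors determine `B` up to its row and column at `a`. If `q ≠ 0`, the lower-order
minors kill these; if `q = 0`, a multiple of `sqOp a` may survive. -/
theorem IsSqPencil.constant_coeff {a q : H} (ha : ⟪a, a⟫_ℂ = 1) (haq : ⟪a, q⟫_ℂ = 0)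
    {B : H →L[ℂ] H} (h : IsSqPencil (sqOp a) (rankOne ℂ q a) (rankOne ℂ a q) B) :
    B = sqOp q ∨ (q = 0 ∧ ∃ t : ℝ, B = t • sqOp a) := by
  have hqa : ⟪q, a⟫_ℂ = 0 := inner_eq_zero_symm.1 haq
  have hB : ∀ u v, ⟪v, B u⟫_ℂ = ⟪q, u⟫_ℂ * ⟪v, q⟫_ℂ + ⟪a, u⟫_ℂ * ⟪v, B a⟫_ℂ +
      ⟪v, a⟫_ℂ * ⟪a, B u⟫_ℂ - ⟪a, u⟫_ℂ * ⟪v, a⟫_ℂ * ⟪a, B a⟫_ℂ := fun u v => by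
    have h3 := (h.minors u v a a).2.2.1
    simp only [rankOne_apply, inner_smul_right, ha, haq, hqa] at h3
    linear_combination h3
  rcases eq_or_ne q 0 with rfl | hq
  · right
    refine ⟨rfl, ?_⟩
    obtain ⟨b, hb⟩ := h 0
    have hb' : B = sqOp b := by simpa using hb
    subst hb'
    obtain ⟨c, rfl⟩ := exists_smul_eq_of_inner_eq_zero (a := b) (b := a) fun u hu => by
      have h1 := hB u u
      have hu' : ⟪u, a⟫_ℂ = 0 := inner_eq_zero_symm.1 hu
      rw [hu, hu', inner_sqOp, inner_zero_left] at h1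
      simp only [zero_mul, add_zero, sub_zero, mul_eq_zero] at h1
      exact h1.elim id fun h => inner_eq_zero_symm.1 h
    exact ⟨_, sqOp_smul c a⟩
  · left
    have hqq : ⟪q, q⟫_ℂ ≠ 0 := by simpa using hq
    have hBa : ∀ u, ⟪a, B u⟫_ℂ = ⟪a, u⟫_ℂ * ⟪a, B a⟫_ℂ := fun u => by
      have h4 := (h.minors u q a a).2.2.2.1
      simp only [rankOne_apply, inner_smul_right, ha, haq] at h4
      refine mul_right_cancel₀ hqq ?_
      linear_combination -h4
    have haB : ∀ v, ⟪v, B a⟫_ℂ = ⟪v, a⟫_ℂ * ⟪a, B a⟫_ℂ := fun v => by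
      have h5 := (h.minors q v a a).2.2.2.2.1
      simp only [rankOne_apply, inner_smul_right, ha, hqa] at h5
      refine mul_left_cancel₀ hqq ?_
      linear_combination -h5
    have hzero : ⟪a, B a⟫_ℂ = 0 := by
      have h6 := (h.minors q q a a).2.2.2.2.2
      rw [hB q q, hBa q, haB q, haq, hqa] at h6
      simpa [hq] using h6
    ext u
    refine ext_inner_left ℂ fun v => ?_
    rw [inner_sqOp, hB, hBa, haB, hzero]
    ring

/-! ### Construction of `T`. -/

theorem star_rankOne (x y : H) : star (rankOne ℂ x y) = rankOne ℂ y x := by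
  rw [ContinuousLinearMap.star_eq_adjoint, adjoint_rankOne]

/-- A group is not the union of two proper subgroups; this makes the choice between `q ⊗ a*` and `a
⊗ q*` uniform in `z`. -/
theorem forall_or_forall_of_forall_or {ι κ E F : Type*} [AddCommGroup E] [AddCommGroup F]
    {f : ι → E →+ F} {g : κ → E →+ F} (h : ∀ z, (∀ i, f i z = 0) ∨ ∀ j, g j z = 0) :
    (∀ z i, f i z = 0) ∨ ∀ z j, g j z = 0 := by
  by_contra! hcon
  obtain ⟨⟨z, i, hi⟩, ⟨z', j, hj⟩⟩ := hcon
  have hz : ∀ j, g j z = 0 := (h z).resolve_left fun h' => hi (h' i)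
  have hz' : ∀ i, f i z' = 0 := (h z').resolve_right fun h' => hj (h' j)
  rcases h (z + z') with h' | h'
  · exact hi (by simpa [hz' i] using h' i)
  · exact hj (by simpa [hz j] using h' j)

/-- A Hermitian quadratic map into the operators of the form `y ⊗ y*` that is injective on rays
is `x ↦ (T x) ⊗ (T x)*` for a linear or conjugate-linear map `T`. -/
theorem exists_linear_or_conjLinear {Q : H → H →L[ℂ] H}
    (hpar : ∀ x z, Q (x + z) + Q (x - z) = (2 : ℝ) • Q x + (2 : ℝ) • Q z)
    (hsmul : ∀ (c : ℂ) x, Q (c • x) = (‖c‖ ^ 2 : ℝ) • Q x)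
    (hbdd : ∃ C : ℝ, 0 ≤ C ∧ ∀ x, ‖Q x‖ ≤ C * ‖x‖ ^ 2) (hsq : ∀ x, ∃ y, Q x = sqOp y)
    (hray : ∀ (x z : H) (t : ℝ), Q x = t • Q z → ∃ c : ℂ, x = c • z)
    {x₀ a : H} (ha : ⟪a, a⟫_ℂ = 1) (hx₀ : Q x₀ = sqOp a) :
    (∃ T : H →ₗ[ℂ] H, ∀ x, Q x = sqOp (T x)) ∨ (∃ T : H →ₗ⋆[ℂ] H, ∀ x, Q x = sqOp (T x)) := by
  have hzero : Q 0 = 0 := by simpa using hsmul 0 0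
  have hsa : ∀ x, star (Q x) = Q x := fun x => by
    obtain ⟨y, hy⟩ := hsq x
    rw [hy, sqOp, star_rankOne]
  obtain ⟨L, hL⟩ := exists_polarization hpar hsmul hbdd hsa x₀
  rw [hx₀] at hL
  have hpencil : ∀ z, IsSqPencil (sqOp a) (L z) (star (L z)) (Q z) := fun z c => by
    obtain ⟨y, hy⟩ := hsq (c • x₀ + z)
    exact ⟨y, by rw [← hy, hL]⟩
  have hLx₀ : L x₀ = sqOp a := by
    have h1 := hL 1 x₀
    have h2 := hL Complex.I x₀
    have e1 : (1 : ℂ) • x₀ + x₀ = (2 : ℂ) • x₀ := by module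
    have e2 : Complex.I • x₀ + x₀ = (Complex.I + 1) • x₀ := by module
    have e3 : ‖Complex.I + 1‖ ^ 2 = 2 := by
      rw [← Complex.normSq_eq_norm_sq]
      simp [Complex.normSq_apply]
      norm_num
    rw [e1, hsmul, hx₀] at h1
    rw [e2, hsmul, hx₀, e3] at h2
    simp only [Complex.norm_I, Complex.conj_I, map_one, norm_one] at h1 h2
    norm_num at h1 h2
    have h3 : Complex.I • (star (L x₀) - L x₀) = 0 := by
      linear_combination (norm := module) -h2
    have h4 : star (L x₀) - L x₀ = 0 := (smul_eq_zero.1 h3).resolve_left Complex.I_ne_zero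
    have h5 : (2 : ℂ) • (L x₀ - sqOp a) = 0 := by
      linear_combination (norm := module) -h1 - h4
    exact sub_eq_zero.1 ((smul_eq_zero.1 h5).resolve_left two_ne_zero)
  have hdich := forall_or_forall_of_forall_or
    (f := fun u => ((ContinuousLinearMap.apply ℂ H u).toLinearMap ∘ₗ L -
      (⟪a, u⟫_ℂ • (ContinuousLinearMap.apply ℂ H a).toLinearMap) ∘ₗ L).toAddMonoidHom)
    (g := fun u => ((ContinuousLinearMap.apply ℂ H u).toLinearMap ∘ₗ L -
      (rankOne ℂ a a).toLinearMap ∘ₗ (ContinuousLinearMap.apply ℂ H u).toLinearMap ∘ₗ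
        L).toAddMonoidHom)
    (fun z => ((hpencil z).linear_coeff ha).imp
      (fun h u => by simpa [sub_eq_zero] using h u) (fun h u => by simpa [sub_eq_zero] using h u))
  have hconst : ∀ (z q : H), ⟪a, q⟫_ℂ = 0 → (L z = rankOne ℂ q a ∨ L z = rankOne ℂ a q) →
      Q z = sqOp q := by
    intro z q haq hLz
    have hp : IsSqPencil (sqOp a) (rankOne ℂ q a) (rankOne ℂ a q) (Q z) := by
      rcases hLz with h | h
      · simpa [h, star_rankOne] using hpencil z
      · simpa [h, star_rankOne] using (hpencil z).symm
    rcases hp.constant_coeff ha haq with h | ⟨rfl, t, ht⟩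
    · exact h
    -- In the degenerate case ray injectivity puts `z` on the line of `x₀`, where `L z = 0` forces
    -- `z = 0`.
    · rw [← hx₀] at ht
      obtain ⟨c, rfl⟩ := hray _ _ _ ht
      rw [map_smul, hLx₀] at hLz
      have h0 : c • sqOp a = 0 := by simpa using hLz
      have ha0 : sqOp a ≠ 0 := by
        rw [ne_eq, sqOp_eq_zero]
        rintro rfl
        simp at ha
      rw [(smul_eq_zero.1 h0).resolve_right ha0, zero_smul, hzero]
      simp [sqOp]
  rcases hdich with h | h
  · left
    have hLz : ∀ z, L z = rankOne ℂ (L z a) a := fun z => by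
      ext u
      simpa [sub_eq_zero] using h z u
    refine ⟨(ContinuousLinearMap.apply ℂ H a).toLinearMap ∘ₗ L, fun z => ?_⟩
    show Q z = sqOp (L z a)
    set k := ⟪a, L z a⟫_ℂ with hk
    -- Subtracting this multiple of `x₀` makes `L z' a` orthogonal to `a`, as `hconst` requires.
    set z' := z - k • x₀ with hz'
    have hLz' : L z' a = L z a - k • a := by
      rw [hz', map_sub, map_smul, hLx₀, sub_apply, smul_apply, sqOp, rankOne_apply, ha, one_smul]
    have hQ := hconst z' (L z' a)
      (by rw [hLz', inner_sub_right, inner_smul_right, ha, mul_one, hk, sub_self])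
      (Or.inl (hLz z'))
    have hz : z = k • x₀ + z' := by rw [hz']; abel
    have hT : L z a = k • a + L z' a := by rw [hLz']; abel
    rw [hT, hz, hL, hQ, hLz z', star_rankOne, ← Complex.coe_smul, Complex.ofReal_pow,
      ← Complex.conj_mul']
    ext u
    simp only [sqOp, rankOne_apply, add_apply, smul_apply, inner_add_left, inner_smul_left, ha, map_one]
    module
  · right
    have hLz : ∀ z, L z = rankOne ℂ a (star (L z) a) := fun z => by
      ext u
      rw [rankOne_apply, ContinuousLinearMap.star_eq_adjoint,
        ContinuousLinearMap.adjoint_inner_left]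
      simpa [sub_eq_zero] using h z u
    refine ⟨{ toFun := fun z => star (L z) a, map_add' := fun z z' => by simp,
              map_smul' := fun c z => by simp }, fun z => ?_⟩
    show Q z = sqOp (star (L z) a)
    set k := ⟪a, star (L z) a⟫_ℂ with hk
    set z' := z - conj k • x₀ with hz'
    have hLz' : star (L z') a = star (L z) a - k • a := by
      rw [hz', map_sub, map_smul, hLx₀, star_sub, star_smul, sub_apply, smul_apply, sqOp,
        star_rankOne, rankOne_apply, ha, one_smul]
      simp
    have hQ := hconst z' (star (L z') a)
      (by rw [hLz', inner_sub_right, inner_smul_right, ha, mul_one, hk, sub_self])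
      (Or.inr (hLz z'))
    have hz : z = conj k • x₀ + z' := by rw [hz']; abel
    have hT : star (L z) a = k • a + star (L z') a := by rw [hLz']; abel
    have hLq := hLz z'
    generalize star (L z') a = q at hLq hQ hT
    rw [hT, hz, hL, hQ, hLq, star_rankOne, ← Complex.coe_smul, Complex.ofReal_pow,
      Complex.norm_conj, ← Complex.conj_mul', Complex.conj_conj]
    ext u
    simp only [sqOp, rankOne_apply, add_apply, smul_apply, inner_add_left, inner_smul_left]
    module

theorem exists_smul_of_sqOp_eq {a b : H} (h : sqOp a = sqOp b) : ∃ c : ℂ, a = c • b :=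
  exists_smul_of_sqOp_le h.le

/-- Since `‖sqOp (T x)‖ = ‖T x‖²`, the bound on `Q` bounds `T`. Surjectivity of `Q` onto rank-one
operators reaches each vector up to a scalar, which `σ'` moves inside `T`. -/
theorem exists_continuousLinearEquiv {σ σ' : ℂ →+* ℂ} [RingHomInvPair σ σ'] [RingHomInvPair σ' σ]
    [RingHomIsometric σ] [RingHomIsometric σ'] {Q : H → H →L[ℂ] H}
    (hbdd : ∃ C : ℝ, 0 ≤ C ∧ ∀ x, ‖Q x‖ ≤ C * ‖x‖ ^ 2)
    (hzero : ∀ x, Q x = 0 → x = 0) (hsurj : ∀ y, ∃ x, Q x = sqOp y)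
    (T : H →ₛₗ[σ] H) (hT : ∀ x, Q x = sqOp (T x)) :
    ∃ S : H ≃SL[σ] H, ∀ x, Q x = sqOp (S x) := by
  obtain ⟨C, hC0, hC⟩ := hbdd
  let T' : H →SL[σ] H := T.mkContinuous (Real.sqrt C) fun x => by
    have h1 := hC x
    rw [hT, sqOp, norm_rankOne] at h1
    refine abs_le_of_sq_le_sq' ?_ (by positivity) |>.2
    rw [mul_pow, Real.sq_sqrt hC0, sq]
    exact h1
  have hT' : ∀ x, T' x = T x := fun x => rfl
  refine ⟨ContinuousLinearEquiv.ofBijective T' ?_ ?_, fun x => ?_⟩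
  · rw [LinearMap.ker_eq_bot']
    intro x hx
    apply hzero
    have : T x = 0 := hx
    rw [hT, this, sqOp_eq_zero]
  · rw [LinearMap.range_eq_top]
    intro v
    obtain ⟨x, hx⟩ := hsurj v
    rw [hT] at hx
    obtain ⟨c, hc⟩ := exists_smul_of_sqOp_eq hx.symm
    refine ⟨σ' c • x, ?_⟩
    show T (σ' c • x) = v
    rw [T.map_smulₛₗ, RingHomInvPair.comp_apply_eq₂, hc]
  · rw [ContinuousLinearEquiv.coeFn_ofBijective, hT', hT]

/-! ### From rank-one operators to the whole cone. -/

/-- An order automorphism is determined by its values on rank-one operators. -/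
theorem eq_of_forall_inner (e : PosOp H ≃o PosOp H) {T S : H → H}
    (hT : ∀ x, sqImage e x = sqOp (T x)) (hS : Function.Surjective S)
    (hTS : ∀ x u, ‖⟪T x, u⟫_ℂ‖ = ‖⟪x, S u⟫_ℂ‖) (A : PosOp H) {C : H →L[ℂ] H}
    (hC : ∀ u, ⟪C u, u⟫_ℂ = ⟪(A : H →L[ℂ] H) (S u), S u⟫_ℂ) :
    (e A : H →L[ℂ] H) = C := by
  have hC0 : 0 ≤ C := by
    rw [ContinuousLinearMap.nonneg_iff_isPositive, ContinuousLinearMap.isPositive_iff_complex]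
    intro u
    have h1 := (ContinuousLinearMap.isPositive_iff_complex _).1 A.2 (S u)
    rwa [← hC] at h1
  have hiff : ∀ x, sqImage e x ≤ e A ↔ sqOp (T x) ≤ C := by
    intro x
    rw [sqImage, Subtype.coe_le_coe, e.le_iff_le, ← Subtype.coe_le_coe, PosOp.coe_sq]
    refine ⟨fun h => le_of_re_inner_le (sqOp_nonneg _) hC0 fun u => ?_,
      fun h => le_of_re_inner_le (sqOp_nonneg _) A.nonneg fun w => ?_⟩
    · rw [hC, re_inner_sqOp, hTS, ← re_inner_sqOp]
      exact re_inner_le_of_le h _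
    · obtain ⟨u, rfl⟩ := hS w
      rw [← hC, re_inner_sqOp, ← hTS, ← re_inner_sqOp]
      exact re_inner_le_of_le h u
  have hiff' : ∀ y, sqOp y ≤ e A ↔ sqOp y ≤ C := fun y => by
    obtain ⟨x, hx⟩ := exists_eq_sqImage e y
    rw [← hx, hiff, hT]
  exact le_antisymm (le_of_forall_sqOp_le (PosOp.nonneg _) hC0 fun y => (hiff' y).1)
    (le_of_forall_sqOp_le hC0 (PosOp.nonneg _) fun y => (hiff' y).2)

end

theorem theorem1 {H : Type*} [NormedAddCommGroup H] [InnerProductSpace ℂ H] [CompleteSpace H]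
    (hdim : 1 < Module.rank ℂ H) (φ : PosOp H → PosOp H) (hφ : Function.Bijective φ)
    (hord : ∀ A B : PosOp H, A ≤ B ↔ φ A ≤ φ B) :
    (∃ T : H ≃L[ℂ] H, ∀ A : PosOp H,
      (φ A : H →L[ℂ] H) =
        (T : H →L[ℂ] H).comp
          ((A : H →L[ℂ] H).comp (ContinuousLinearMap.adjoint (T : H →L[ℂ] H)))) ∨
    (∃ T : H ≃L⋆[ℂ] H, ∀ A : PosOp H,
      (φ A : H →L[ℂ] H) =
        (T : H →L⋆[ℂ] H).comp
          ((A : H →L[ℂ] H).comp (conjAdjoint (T : H →L⋆[ℂ] H)))) := by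
  let e : PosOp H ≃o PosOp H :=
    { toEquiv := Equiv.ofBijective φ hφ
      map_rel_iff' := fun {A B} => (hord A B).symm }
  -- Orthogonality to `0` is vacuous; this only supplies a nonzero vector to normalize.
  obtain ⟨v, hv, -⟩ := exists_ne_zero_inner_eq_zero hdim (0 : H)
  have hvn : (‖v‖ : ℂ) ≠ 0 := by simpa using hv
  obtain ⟨x₀, hx₀⟩ := exists_eq_sqImage e ((‖v‖⁻¹ : ℂ) • v)
  have ha : ⟪(‖v‖⁻¹ : ℂ) • v, (‖v‖⁻¹ : ℂ) • v⟫_ℂ = 1 := by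
    have : ⟪v, v⟫_ℂ = (‖v‖ : ℂ) ^ 2 := inner_self_eq_norm_sq_to_K v
    rw [inner_smul_left, inner_smul_right, this, map_inv₀, Complex.conj_ofReal]
    field_simp
  have hray : ∀ (x z : H) (t : ℝ), sqImage e x = t • sqImage e z → ∃ c : ℂ, x = c • z := by
    intro x z t h
    rcases eq_or_ne z 0 with rfl | hz
    · rw [sqImage_zero, smul_zero, sqImage_eq_zero] at h
      exact ⟨0, by simp [h]⟩
    have hcmp := sqOp_le_or_le_of_eq_smul (sqImage_nonneg e z) h
    rw [sqImage_le_iff, sqImage_le_iff] at hcmp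
    rcases hcmp with h' | h'
    · obtain ⟨c, rfl⟩ := exists_smul_of_sqOp_le h'
      have hc : c ≠ 0 := by
        rintro rfl
        simp at hz
      exact ⟨c⁻¹, by rw [smul_smul, inv_mul_cancel₀ hc, one_smul]⟩
    · exact exists_smul_of_sqOp_le h'
  have hbdd := norm_sqImage_le e hdim
  have hz : ∀ x, sqImage e x = 0 → x = 0 := fun x => (sqImage_eq_zero e).1
  rcases exists_linear_or_conjLinear (sqImage_parallelogram e hdim) (sqImage_smul e hdim) hbdd
    (exists_sqImage_eq e) hray ha hx₀ with ⟨T, hT⟩ | ⟨T, hT⟩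
  · left
    obtain ⟨S, hS⟩ := exists_continuousLinearEquiv hbdd hz (exists_eq_sqImage e) T hT
    have hadj : ∀ x u, ⟪x, ContinuousLinearMap.adjoint (S : H →L[ℂ] H) u⟫_ℂ = ⟪S x, u⟫_ℂ :=
      fun x u => ContinuousLinearMap.adjoint_inner_right _ _ _
    refine ⟨S, fun A => eq_of_forall_inner e hS
      (S := ContinuousLinearMap.adjoint (S : H →L[ℂ] H)) (fun w => ?_) (fun x u => ?_) A
      fun u => ?_⟩
    · refine ⟨ContinuousLinearMap.adjoint (S.symm : H →L[ℂ] H) w, ext_inner_left ℂ fun x => ?_⟩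
      rw [hadj, ContinuousLinearMap.adjoint_inner_right, ContinuousLinearEquiv.coe_coe,
        S.symm_apply_apply]
    · rw [hadj]
    · rw [hadj, ← inner_conj_symm, ← inner_conj_symm (S _)]
      rfl
  · right
    obtain ⟨S, hS⟩ := exists_continuousLinearEquiv hbdd hz (exists_eq_sqImage e) T hT
    refine ⟨S, fun A => eq_of_forall_inner e hS
      (S := conjAdjoint (S : H →L⋆[ℂ] H)) (fun w => ?_) (fun x u => ?_) A
      fun u => ?_⟩
    · refine ⟨conjAdjoint (S.symm : H →L⋆[ℂ] H) w, ext_inner_right ℂ fun x => ?_⟩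
      rw [conjAdjoint_inner, ← inner_conj_symm, ContinuousLinearEquiv.coe_coe, conjAdjoint_inner,
        inner_conj_symm, ContinuousLinearEquiv.coe_coe, S.symm_apply_apply]
    · rw [norm_inner_symm x, conjAdjoint_inner]
      rfl
    · rw [A.2.inner_left_eq_inner_right, conjAdjoint_inner]
      rfl
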